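/- Let $\mathbb G=(A,\Delta)$ be a compact quantum group: $A=C(\mathbb G)$ is a unital C*-algebra and $\Delta:A\to A\otimes A$ (minimal C*-tensor product) is a unital $*$-homomorphism with $(\Delta\otimes\iota)\Delta=(\iota\otimes\Delta)\Delta$ such that the linear spans of $\{\Delta(a)(b\otimes 1):a,b\in A\}$ and of $\{\Delta(a)(1\otimes b):a,b\in A\}$ are dense in $A\otimes A$. The Haar state of $\mathbb G$ is the unique state $h$ on $A$ with $(h\otimes\iota)\Delta(x)=h(x)1=(\iota\otimes h)\Delta(x)$ for all $x\in A$. For states $\varphi,\psi$ on $A$ put $\varphi\star\psi=(\varphi\otimes\psi)\circ\Delta$; let $\varphi^{\star k}$ $(k\ge1)$ be the $k$-fold convolution power of $\varphi$, and let $\varphi^{\star 0}$ be the state $\varepsilon$ with $(\varepsilon\otimes\iota)\Delta=\iota=(\iota\otimes\varepsilon)\Delta$ (the counit), if there is one on $A$; if there is none, the exponent $k=0$ is disregarded. Let $\varphi$ be a state on $A$. (1) If $\varphi$ is non-degenerate, that is, for every nonzero $x\in A$ with $x\ge0$ there is $k\ge0$ with $\varphi^{\star k}(x)>0$, then the Haar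 state $h$ exists, is unique, and $$w^*\text{-}\lim_{n\to\infty}\frac1n\sum_{k=1}^n\varphi^{\star k}=h .$$ (2) Conversely, if the Haar state $h$ is faithful on $A$ (that is, $x\ge0$ and $h(x)=0$ imply $x=0$) and $w^*\text{-}\lim_{n\to\infty}\frac1n\sum_{k=1}^n\varphi^{\star k}=h$, then $\varphi$ is non-degenerate; indeed for every nonzero $x\ge0$ in $A$ there is $k\ge1$ with $\varphi^{\star k}(x)>0$. -/

import Mathlib

open scoped TensorProduct ComplexOrder

noncomputable section

namespace CQG

universe u

/-! ### Representations and the spatial (minimal) tensor product -/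

/-- A unital `*`-representation of a unital C*-algebra on a Hilbert space. -/
structure HilbertRep (A : Type u) [CStarAlgebra A] where
  H : Type u
  [normedAddCommGroup : NormedAddCommGroup H]
  [innerProductSpace : InnerProductSpace ℂ H]
  [completeSpace : CompleteSpace H]
  π : A →⋆ₐ[ℂ] (H →L[ℂ] H)

attribute [instance] HilbertRep.normedAddCommGroup HilbertRep.innerProductSpace
  HilbertRep.completeSpace

section Tensor

variable {A B C D : Type u} [CStarAlgebra A] [CStarAlgebra B] [CStarAlgebra C] [CStarAlgebra D]

/-- Restriction of a representation along a unital `*`-homomorphism. -/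
def HilbertRep.comp (π : HilbertRep B) (f : A →⋆ₐ[ℂ] B) : HilbertRep A where
  H := π.H
  π := π.π.comp f

/-- The Hilbert space tensor product: the completion of the algebraic tensor product with the
inner product `⟪h ⊗ k, h' ⊗ k'⟫ = ⟪h, h'⟫ ⟪k, k'⟫`. -/
def HilbertTensor (H K : Type u) [NormedAddCommGroup H] [InnerProductSpace ℂ H]
    [NormedAddCommGroup K] [InnerProductSpace ℂ K] : Type u :=
  UniformSpace.Completion (H ⊗[ℂ] K)

section Operators

variable {H K : Type u} [NormedAddCommGroup H] [InnerProductSpace ℂ H]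
  [NormedAddCommGroup K] [InnerProductSpace ℂ K]

instance : NormedAddCommGroup (HilbertTensor H K) :=
  inferInstanceAs (NormedAddCommGroup (UniformSpace.Completion (H ⊗[ℂ] K)))
instance : InnerProductSpace ℂ (HilbertTensor H K) :=
  inferInstanceAs (InnerProductSpace ℂ (UniformSpace.Completion (H ⊗[ℂ] K)))
instance : CompleteSpace (HilbertTensor H K) :=
  inferInstanceAs (CompleteSpace (UniformSpace.Completion (H ⊗[ℂ] K)))

/-- The inclusion of the algebraic tensor product. -/
def HilbertTensor.incl : H ⊗[ℂ] K →ₗᵢ[ℂ] HilbertTensor H K :=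
  (UniformSpace.Completion.toComplₗᵢ (𝕜 := ℂ) (E := H ⊗[ℂ] K))

/-- The elementary tensor `h ⊗ k`. -/
def HilbertTensor.tmul (h : H) (k : K) : HilbertTensor H K := HilbertTensor.incl (h ⊗ₜ[ℂ] k)

lemma HilbertTensor.inner_tmul (h h' : H) (k k' : K) :
    inner ℂ (HilbertTensor.tmul h k) (HilbertTensor.tmul h' k')
      = inner ℂ h h' * inner ℂ k k' :=
  (HilbertTensor.incl (H := H) (K := K)).inner_map_map (h ⊗ₜ[ℂ] k) (h' ⊗ₜ[ℂ] k')

lemma HilbertTensor.norm_tmul (h : H) (k : K) : ‖HilbertTensor.tmul h k‖ = ‖h‖ * ‖k‖ :=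
  ((HilbertTensor.incl (H := H) (K := K)).norm_map (h ⊗ₜ[ℂ] k)).trans (TensorProduct.norm_tmul h k)

lemma HilbertTensor.induction_incl {p : HilbertTensor H K → Prop} (x : HilbertTensor H K)
    (hc : IsClosed {x | p x}) (ht : ∀ t, p (HilbertTensor.incl t)) : p x :=
  UniformSpace.Completion.induction_on (α := H ⊗[ℂ] K) x hc ht

lemma HilbertTensor.induction {p : HilbertTensor H K → Prop} (x : HilbertTensor H K)
    (hc : IsClosed {x | p x}) (h0 : p 0) (hadd : ∀ x y, p x → p y → p (x + y))
    (ht : ∀ (h : H) (k : K), p (HilbertTensor.tmul h k)) : p x := by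
  refine HilbertTensor.induction_incl x hc fun x => ?_
  induction x using TensorProduct.induction_on with
  | zero => rw [map_zero]; exact h0
  | tmul h k => exact ht h k
  | add x y hx hy => rw [map_add]; exact hadd _ _ hx hy

lemma HilbertTensor.ext {L M : HilbertTensor H K →L[ℂ] HilbertTensor H K}
    (h : ∀ (h : H) (k : K), L (HilbertTensor.tmul h k) = M (HilbertTensor.tmul h k)) :
    L = M := by
  refine ContinuousLinearMap.ext fun x => ?_
  induction x using HilbertTensor.induction with
  | hc => exact isClosed_eq L.continuous M.continuous
  | h0 => rw [map_zero, map_zero]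
  | hadd x y hx hy => rw [map_add, map_add, hx, hy]
  | ht a b => exact h a b

/-- The operator `S ⊗ T` on the Hilbert space tensor product. -/
def opTensor (S : H →L[ℂ] H) (T : K →L[ℂ] K) : HilbertTensor H K →L[ℂ] HilbertTensor H K :=
  (TensorProduct.mapL S T).completion

lemma opTensor_incl (S : H →L[ℂ] H) (T : K →L[ℂ] K) (t : H ⊗[ℂ] K) :
    opTensor S T (HilbertTensor.incl t) = HilbertTensor.incl (TensorProduct.mapL S T t) :=
  (TensorProduct.mapL S T).completion_apply_coe t

lemma opTensor_tmul (S : H →L[ℂ] H) (T : K →L[ℂ] K) (h : H) (k : K) :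
    opTensor S T (HilbertTensor.tmul h k) = HilbertTensor.tmul (S h) (T k) :=
  opTensor_incl S T (h ⊗ₜ[ℂ] k)

lemma norm_opTensor_le (S : H →L[ℂ] H) (T : K →L[ℂ] K) : ‖opTensor S T‖ ≤ ‖S‖ * ‖T‖ := by
  refine ContinuousLinearMap.opNorm_le_bound _ (by positivity) fun x => ?_
  induction x using HilbertTensor.induction_incl with
  | hc => exact isClosed_le (by fun_prop) (by fun_prop)
  | ht x =>
    rw [opTensor_incl, LinearIsometry.norm_map, LinearIsometry.norm_map]
    exact ((TensorProduct.mapL S T).le_opNorm x).trans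
      (mul_le_mul_of_nonneg_right (TensorProduct.norm_mapL_le S T) (norm_nonneg _))

lemma opTensor_add_left (S S' : H →L[ℂ] H) (T : K →L[ℂ] K) :
    opTensor (S + S') T = opTensor S T + opTensor S' T := by
  refine HilbertTensor.ext fun h k => ?_
  rw [add_apply, opTensor_tmul, opTensor_tmul, opTensor_tmul, add_apply]
  simp only [HilbertTensor.tmul, TensorProduct.add_tmul, map_add]

lemma opTensor_add_right (S : H →L[ℂ] H) (T T' : K →L[ℂ] K) :
    opTensor S (T + T') = opTensor S T + opTensor S T' := by
  refine HilbertTensor.ext fun h k => ?_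
  rw [add_apply, opTensor_tmul, opTensor_tmul, opTensor_tmul, add_apply]
  simp only [HilbertTensor.tmul, TensorProduct.tmul_add, map_add]

lemma opTensor_smul_left (c : ℂ) (S : H →L[ℂ] H) (T : K →L[ℂ] K) :
    opTensor (c • S) T = c • opTensor S T := by
  refine HilbertTensor.ext fun h k => ?_
  rw [smul_apply, opTensor_tmul, opTensor_tmul, smul_apply]
  exact (congrArg _ (TensorProduct.smul_tmul' c (S h) (T k)).symm).trans
    ((HilbertTensor.incl (H := H) (K := K)).map_smul c _)

lemma opTensor_smul_right (c : ℂ) (S : H →L[ℂ] H) (T : K →L[ℂ] K) :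
    opTensor S (c • T) = c • opTensor S T := by
  refine HilbertTensor.ext fun h k => ?_
  rw [smul_apply, opTensor_tmul, opTensor_tmul, smul_apply]
  exact (congrArg _ (TensorProduct.tmul_smul c (S h) (T k))).trans
    ((HilbertTensor.incl (H := H) (K := K)).map_smul c _)

lemma opTensor_mul (S S' : H →L[ℂ] H) (T T' : K →L[ℂ] K) :
    opTensor (S * S') (T * T') = opTensor S T * opTensor S' T' := by
  refine HilbertTensor.ext fun h k => ?_
  simp only [mul_apply_eq_comp, opTensor_tmul]

lemma opTensor_one : opTensor (1 : H →L[ℂ] H) (1 : K →L[ℂ] K) = 1 := by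
  refine HilbertTensor.ext fun h k => ?_
  simp only [opTensor_tmul, one_apply_eq_self]

lemma opTensor_star [CompleteSpace H] [CompleteSpace K] (S : H →L[ℂ] H) (T : K →L[ℂ] K) :
    opTensor (star S) (star T) = star (opTensor S T) := by
  refine (ContinuousLinearMap.eq_adjoint_iff _ _).mpr fun x y => ?_
  induction x using HilbertTensor.induction with
  | hc => exact isClosed_eq (by fun_prop) (by fun_prop)
  | h0 => simp
  | hadd x x' hx hx' => rw [map_add, inner_add_left, inner_add_left, hx, hx']
  | ht h k =>
    induction y using HilbertTensor.induction with
    | hc => exact isClosed_eq (by fun_prop) (by fun_prop)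
    | h0 => simp
    | hadd y y' hy hy' => rw [map_add, inner_add_right, inner_add_right, hy, hy']
    | ht h' k' =>
      simp only [opTensor_tmul, HilbertTensor.inner_tmul,
        ContinuousLinearMap.star_eq_adjoint, ContinuousLinearMap.adjoint_inner_left]

end Operators

/-- The linear map `a ⊗ b ↦ π(a) ⊗ ρ(b)` into the bounded operators. -/
def tensorRepₗ (π : HilbertRep A) (ρ : HilbertRep B) :
    A ⊗[ℂ] B →ₗ[ℂ] (HilbertTensor π.H ρ.H →L[ℂ] HilbertTensor π.H ρ.H) :=
  TensorProduct.lift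
    (LinearMap.mk₂ ℂ (fun a b => opTensor (π.π a) (ρ.π b))
      (fun a a' b => by rw [map_add, opTensor_add_left])
      (fun c a b => by rw [map_smul, opTensor_smul_left])
      (fun a b b' => by rw [map_add, opTensor_add_right])
      (fun c a b => by rw [map_smul, opTensor_smul_right]))

/-- The representation `π ⊗ ρ` of the algebraic tensor product. -/
def tensorRep (π : HilbertRep A) (ρ : HilbertRep B) :
    A ⊗[ℂ] B →ₐ[ℂ] (HilbertTensor π.H ρ.H →L[ℂ] HilbertTensor π.H ρ.H) :=
  Algebra.TensorProduct.algHomOfLinearMapTensorProduct (tensorRepₗ π ρ)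
    (fun a a' b b' => by simp [tensorRepₗ, opTensor_mul])
    (by simp [tensorRepₗ, opTensor_one])

lemma tensorRep_tmul (π : HilbertRep A) (ρ : HilbertRep B) (a : A) (b : B) :
    tensorRep π ρ (a ⊗ₜ b) = opTensor (π.π a) (ρ.π b) := rfl

lemma tensorRep_star (π : HilbertRep A) (ρ : HilbertRep B) (t : A ⊗[ℂ] B) :
    tensorRep π ρ (star t) = star (tensorRep π ρ t) := by
  induction t using TensorProduct.induction_on with
  | zero => simp
  | tmul a b => rw [TensorProduct.star_tmul, tensorRep_tmul, tensorRep_tmul, map_star, map_star,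
      opTensor_star]
  | add s t hs ht => rw [star_add, map_add, map_add, star_add, hs, ht]

/-- The set of the norms `‖(π ⊗ ρ)(t)‖`. -/
def repNorms (t : A ⊗[ℂ] B) : Set ℝ :=
  {r | ∃ (π : HilbertRep A) (ρ : HilbertRep B), r = ‖tensorRep π ρ t‖}

/-- The minimal (spatial) C*-norm `sup ‖(π ⊗ ρ)(t)‖` on the algebraic tensor product. -/
def minNorm (t : A ⊗[ℂ] B) : ℝ := sSup (repNorms t)

lemma bddAbove_repNorms (t : A ⊗[ℂ] B) : BddAbove (repNorms t) := by
  suffices h : ∃ c : ℝ, ∀ (π : HilbertRep A) (ρ : HilbertRep B), ‖tensorRep π ρ t‖ ≤ c by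
    obtain ⟨c, hc⟩ := h
    exact ⟨c, by rintro _ ⟨π, ρ, rfl⟩; exact hc π ρ⟩
  induction t using TensorProduct.induction_on with
  | zero => exact ⟨0, fun π ρ => by simp⟩
  | tmul a b =>
    refine ⟨‖a‖ * ‖b‖, fun π ρ => ?_⟩
    rw [tensorRep_tmul]
    refine (norm_opTensor_le _ _).trans ?_
    gcongr
    · exact NonUnitalStarAlgHom.norm_apply_le π.π a
    · exact NonUnitalStarAlgHom.norm_apply_le ρ.π b
  | add x y hx hy =>
    obtain ⟨c, hc⟩ := hx
    obtain ⟨d, hd⟩ := hy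
    exact ⟨c + d, fun π ρ => by
      rw [map_add]; exact (norm_add_le _ _).trans (add_le_add (hc π ρ) (hd π ρ))⟩

lemma norm_tensorRep_le (π : HilbertRep A) (ρ : HilbertRep B) (t : A ⊗[ℂ] B) :
    ‖tensorRep π ρ t‖ ≤ minNorm t :=
  le_csSup (bddAbove_repNorms t) ⟨π, ρ, rfl⟩

lemma minNorm_nonneg (t : A ⊗[ℂ] B) : 0 ≤ minNorm t :=
  Real.sSup_nonneg (by rintro _ ⟨π, ρ, rfl⟩; positivity)

lemma minNorm_le {t : A ⊗[ℂ] B} {c : ℝ} (hc : 0 ≤ c)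
    (h : ∀ (π : HilbertRep A) (ρ : HilbertRep B), ‖tensorRep π ρ t‖ ≤ c) : minNorm t ≤ c :=
  Real.sSup_le (by rintro _ ⟨π, ρ, rfl⟩; exact h π ρ) hc

lemma minNorm_mul_self_le (t : A ⊗[ℂ] B) : minNorm t * minNorm t ≤ minNorm (star t * t) := by
  have key : minNorm t ≤ Real.sqrt (minNorm (star t * t)) := by
    refine minNorm_le (Real.sqrt_nonneg _) fun π ρ => Real.le_sqrt_of_sq_le ?_
    rw [sq, ← CStarRing.norm_star_mul_self, ← tensorRep_star, ← map_mul]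
    exact norm_tensorRep_le _ _ _
  calc minNorm t * minNorm t
      ≤ Real.sqrt (minNorm (star t * t)) * Real.sqrt (minNorm (star t * t)) :=
        mul_self_le_mul_self (minNorm_nonneg _) key
    _ = _ := Real.mul_self_sqrt (minNorm_nonneg _)

lemma minNorm_mul_le (s t : A ⊗[ℂ] B) : minNorm (s * t) ≤ minNorm s * minNorm t := by
  refine minNorm_le (mul_nonneg (minNorm_nonneg _) (minNorm_nonneg _)) fun π ρ => ?_
  rw [map_mul]
  exact (norm_mul_le _ _).trans (mul_le_mul (norm_tensorRep_le _ _ _) (norm_tensorRep_le _ _ _)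
    (norm_nonneg _) (minNorm_nonneg _))

lemma minNorm_star_le (t : A ⊗[ℂ] B) : minNorm t ≤ minNorm (star t) := by
  rcases (minNorm_nonneg t).eq_or_lt with h | h
  · rw [← h]; exact minNorm_nonneg _
  · exact le_of_mul_le_mul_right ((minNorm_mul_self_le t).trans (minNorm_mul_le _ _)) h

lemma minNorm_smul_le (c : ℂ) (t : A ⊗[ℂ] B) : minNorm (c • t) ≤ ‖c‖ * minNorm t := by
  refine minNorm_le (mul_nonneg (norm_nonneg _) (minNorm_nonneg _)) fun π ρ => ?_
  rw [map_smul, norm_smul]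
  gcongr
  exact norm_tensorRep_le _ _ _

variable (A B) in
/-- The minimal norm as a ring seminorm. -/
def minSeminorm : RingSeminorm (A ⊗[ℂ] B) where
  toFun := minNorm
  map_zero' := le_antisymm (minNorm_le le_rfl fun π ρ => by simp) (minNorm_nonneg _)
  add_le' s t := minNorm_le (add_nonneg (minNorm_nonneg _) (minNorm_nonneg _)) fun π ρ => by
    rw [map_add]
    exact (norm_add_le _ _).trans (add_le_add (norm_tensorRep_le _ _ _) (norm_tensorRep_le _ _ _))
  neg' t := by
    have h : ∀ s : A ⊗[ℂ] B, minNorm (-s) ≤ minNorm s := fun s =>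
      minNorm_le (minNorm_nonneg _) fun π ρ => by
        rw [map_neg, norm_neg]; exact norm_tensorRep_le _ _ _
    exact le_antisymm (h t) (by simpa using h (-t))
  mul_le' := minNorm_mul_le

variable (A B) in
/-- The algebraic tensor product, equipped with the minimal norm. -/
def PreMin : Type u := A ⊗[ℂ] B

namespace PreMin

instance : Ring (PreMin A B) := inferInstanceAs (Ring (A ⊗[ℂ] B))
instance : Algebra ℂ (PreMin A B) := inferInstanceAs (Algebra ℂ (A ⊗[ℂ] B))
instance : StarRing (PreMin A B) := inferInstanceAs (StarRing (A ⊗[ℂ] B))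
instance : StarModule ℂ (PreMin A B) := inferInstanceAs (StarModule ℂ (A ⊗[ℂ] B))

instance : SeminormedRing (PreMin A B) :=
  { (minSeminorm A B).toSeminormedRing with
    toRing := inferInstanceAs (Ring (PreMin A B)) }

instance : NormedAlgebra ℂ (PreMin A B) where
  norm_smul_le c t := minNorm_smul_le (A := A) (B := B) c t

variable (A B) in
/-- The identity map from the algebraic tensor product to its normed copy. -/
def of : A ⊗[ℂ] B ≃ₗ[ℂ] PreMin A B := LinearEquiv.refl ℂ _

lemma norm_of (t : A ⊗[ℂ] B) : ‖of A B t‖ = minNorm t := rfl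

instance : NormedStarGroup (PreMin A B) where
  norm_star_le t := by
    have h : ‖star t‖ ≤ ‖star (star t)‖ := minNorm_star_le (A := A) (B := B) (star t)
    rwa [star_star] at h

lemma norm_mul_self_le (t : PreMin A B) : ‖t‖ * ‖t‖ ≤ ‖star t * t‖ :=
  minNorm_mul_self_le (A := A) (B := B) t

end PreMin

variable (A B) in
/-- The minimal (spatial) C*-tensor product: the completion of the algebraic tensor product in the
minimal C*-norm. -/
def MinTensor : Type u := UniformSpace.Completion (PreMin A B)

namespace MinTensor

open UniformSpace

instance : NormedRing (MinTensor A B) :=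
  inferInstanceAs (NormedRing (Completion (PreMin A B)))

instance : NormedAlgebra ℂ (MinTensor A B) :=
  { toAlgebra := inferInstanceAs (Algebra ℂ (Completion (PreMin A B)))
    norm_smul_le := fun c (x : Completion (PreMin A B)) => norm_smul_le c x }

instance : CompleteSpace (MinTensor A B) :=
  inferInstanceAs (CompleteSpace (Completion (PreMin A B)))

/-- The involution, extended by continuity from the algebraic tensor product. -/
instance : Star (MinTensor A B) :=
  ⟨(Completion.map (star : PreMin A B → PreMin A B) :
    Completion (PreMin A B) → Completion (PreMin A B))⟩

variable (A B) in
/-- The inclusion of the algebraic tensor product. -/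
def incl : A ⊗[ℂ] B →ₐ[ℂ] MinTensor A B where
  toFun t := ((PreMin.of A B t : PreMin A B) : Completion (PreMin A B))
  map_one' := Completion.coe_one (PreMin A B)
  map_mul' s t := Completion.coe_mul (α := PreMin A B) s t
  map_zero' := Completion.coe_zero (α := PreMin A B)
  map_add' s t := Completion.coe_add (α := PreMin A B) s t
  commutes' _ := rfl

/-- The elementary tensor `a ⊗ b` in the minimal tensor product. -/
def tmul (a : A) (b : B) : MinTensor A B := incl A B (a ⊗ₜ b)

lemma norm_incl (t : A ⊗[ℂ] B) : ‖incl A B t‖ = minNorm t :=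
  Completion.norm_coe (E := PreMin A B) (PreMin.of A B t)

lemma dense_incl : DenseRange (incl A B) := Completion.denseRange_coe (α := PreMin A B)

lemma induction {p : MinTensor A B → Prop} (x : MinTensor A B)
    (hc : IsClosed {x | p x}) (ht : ∀ t, p (incl A B t)) : p x :=
  Completion.induction_on (α := PreMin A B) x hc ht

lemma continuous_star' : Continuous (star : MinTensor A B → MinTensor A B) :=
  Completion.continuous_map

lemma star_incl (t : A ⊗[ℂ] B) : star (incl A B t) = incl A B (star t) :=
  Completion.map_coe
    (AddMonoidHomClass.isometry_of_norm (starAddEquiv (R := PreMin A B))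
      (fun x => norm_star x)).uniformContinuous (PreMin.of A B t)

instance : StarRing (MinTensor A B) where
  star_involutive x := by
    induction x using induction with
    | hc => exact isClosed_eq (continuous_star'.comp continuous_star') continuous_id
    | ht x => rw [star_incl, star_incl, star_star]
  star_mul x y := by
    induction x using induction with
    | hc =>
      exact isClosed_eq (continuous_star'.comp (continuous_mul_const y))
        ((continuous_const_mul _).comp continuous_star')
    | ht x =>
      induction y using induction with
      | hc =>
        exact isClosed_eq (continuous_star'.comp (continuous_const_mul _))
          ((continuous_mul_const _).comp continuous_star')
      | ht y => rw [← map_mul, star_incl, star_incl, star_incl, ← map_mul, star_mul]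
  star_add x y := by
    induction x using induction with
    | hc =>
      exact isClosed_eq (continuous_star'.comp (continuous_add_const y))
        ((continuous_add_const _).comp continuous_star')
    | ht x =>
      induction y using induction with
      | hc =>
        exact isClosed_eq (continuous_star'.comp (continuous_const_add _))
          ((continuous_const_add _).comp continuous_star')
      | ht y => rw [← map_add, star_incl, star_incl, star_incl, ← map_add, star_add]

instance : CStarRing (MinTensor A B) where
  norm_mul_self_le x := by
    induction x using induction with
    | hc =>
      exact isClosed_le (continuous_norm.mul continuous_norm)
        (continuous_norm.comp (continuous_star'.mul continuous_id))
    | ht x =>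
      rw [star_incl, ← map_mul, norm_incl, norm_incl]
      exact minNorm_mul_self_le x

instance : StarModule ℂ (MinTensor A B) where
  star_smul c x := by
    induction x using induction with
    | hc =>
      exact isClosed_eq (continuous_star'.comp (continuous_const_smul c))
        ((continuous_const_smul (star c)).comp continuous_star')
    | ht x => rw [← map_smul, star_incl, star_incl, star_smul, map_smul]

instance : CStarAlgebra (MinTensor A B) where

/-- Extension by continuity of a linear map that is contractive for the minimal norm. -/
def extend {E : Type u} [NormedAddCommGroup E] [NormedSpace ℂ E] [CompleteSpace E]
    (f : A ⊗[ℂ] B →ₗ[ℂ] E) (hf : ∀ t, ‖f t‖ ≤ minNorm t) : MinTensor A B →L[ℂ] E :=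
  ((f ∘ₗ (PreMin.of A B).symm.toLinearMap).mkContinuous 1 (fun t => by
    rw [one_mul]; exact hf t) : PreMin A B →L[ℂ] E).fromCompletion

lemma extend_incl {E : Type u} [NormedAddCommGroup E] [NormedSpace ℂ E] [CompleteSpace E]
    (f : A ⊗[ℂ] B →ₗ[ℂ] E) (hf : ∀ t, ‖f t‖ ≤ minNorm t) (t : A ⊗[ℂ] B) :
    extend f hf (incl A B t) = f t :=
  ContinuousLinearMap.fromCompletion_apply_coe _ (PreMin.of A B t)

lemma minNorm_map_le (f : A →⋆ₐ[ℂ] C) (g : B →⋆ₐ[ℂ] D) (t : A ⊗[ℂ] B) :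
    minNorm (TensorProduct.map f.toAlgHom.toLinearMap g.toAlgHom.toLinearMap t) ≤ minNorm t := by
  refine minNorm_le (minNorm_nonneg _) fun π ρ => ?_
  have h : tensorRep π ρ (TensorProduct.map f.toAlgHom.toLinearMap g.toAlgHom.toLinearMap t)
      = tensorRep (π.comp f) (ρ.comp g) t := by
    induction t using TensorProduct.induction_on with
    | zero => rw [map_zero, map_zero]; exact (map_zero _).symm
    | tmul a b => rfl
    | add s t hs ht => rw [map_add, map_add, hs, ht]; exact (map_add _ _ _).symm
  rw [h]
  exact norm_tensorRep_le (π.comp f) (ρ.comp g) t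

/-- The map `f ⊗ g` between minimal tensor products, for unital `*`-homomorphisms `f`, `g`. -/
def map (f : A →⋆ₐ[ℂ] C) (g : B →⋆ₐ[ℂ] D) : MinTensor A B →L[ℂ] MinTensor C D :=
  extend ((incl C D).toLinearMap ∘ₗ TensorProduct.map f.toAlgHom.toLinearMap g.toAlgHom.toLinearMap)
    (fun t => (norm_incl _).trans_le (minNorm_map_le f g t))

lemma map_tmul (f : A →⋆ₐ[ℂ] C) (g : B →⋆ₐ[ℂ] D) (a : A) (b : B) :
    map f g (tmul a b) = tmul (f a) (g b) :=
  extend_incl _ _ _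

end MinTensor

end Tensor

/-! ### States and slice maps -/

/-- A state: a positive linear functional with value `1` at the unit. -/
structure State (A : Type u) [CStarAlgebra A] [PartialOrder A] [StarOrderedRing A]
    extends A →ₚ[ℂ] ℂ where
  apply_one' : toPositiveLinearMap 1 = 1

section States

variable {A B : Type u} [CStarAlgebra A] [PartialOrder A] [StarOrderedRing A]
  [CStarAlgebra B]

instance : CoeFun (State A) (fun _ => A → ℂ) := ⟨fun φ => φ.toPositiveLinearMap⟩

/-- A state as a continuous linear functional. -/
def State.toDual (φ : State A) : StrongDual ℂ A :=
  ⟨φ.toLinearMap, map_continuous φ.toPositiveLinearMap⟩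

@[simp] lemma State.toDual_apply (φ : State A) (a : A) : φ.toDual a = φ a := rfl

/-- The GNS representation of a state. -/
def State.gns (φ : State A) : HilbertRep A where
  H := φ.toPositiveLinearMap.GNS
  π := φ.toPositiveLinearMap.gnsStarAlgHom

/-- The cyclic vector of the GNS representation. -/
def State.vec (φ : State A) : φ.gns.H :=
  ((φ.toPositiveLinearMap.toPreGNS 1 : φ.toPositiveLinearMap.PreGNS) :
    φ.toPositiveLinearMap.GNS)

lemma State.gns_vec (φ : State A) (a : A) :
    φ.gns.π a φ.vec = ((φ.toPositiveLinearMap.toPreGNS a : φ.toPositiveLinearMap.PreGNS) :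
      φ.toPositiveLinearMap.GNS) := by
  refine (φ.toPositiveLinearMap.gnsNonUnitalStarAlgHom_apply_coe).trans ?_
  simp

lemma State.inner_vec (φ : State A) (a : A) : inner ℂ φ.vec (φ.gns.π a φ.vec) = φ a := by
  rw [State.gns_vec]
  refine (UniformSpace.Completion.inner_coe _ _).trans ?_
  rw [PositiveLinearMap.preGNS_inner_def]
  simp

lemma State.norm_vec (φ : State A) : ‖φ.vec‖ = 1 := by
  have h := φ.inner_vec 1
  rw [map_one, one_apply_eq_self, φ.apply_one', inner_self_eq_norm_sq_to_K] at h
  have h' : ‖φ.vec‖ ^ 2 = 1 := by exact Complex.ofReal_injective (by simpa using h)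
  nlinarith [norm_nonneg φ.vec]

/-- A functional of norm at most one that maps the unit to one is positive. -/
lemma nonneg_of_norm_le_one (f : StrongDual ℂ A) (hf : ‖f‖ ≤ 1) (h1 : f 1 = 1) {a : A}
    (ha : 0 ≤ a) : 0 ≤ f a := by
  have hfx : ∀ x, ‖f x‖ ≤ ‖x‖ := fun x => by
    simpa using (f.le_opNorm x).trans (mul_le_mul_of_nonneg_right hf (norm_nonneg x))
  have hsa : IsSelfAdjoint a := .of_nonneg ha
  have hscal : ∀ c : ℂ, f (algebraMap ℂ A c) = c := fun c => by
    rw [Algebra.algebraMap_eq_smul_one, map_smul, h1, smul_eq_mul, mul_one]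
  have him : (f a).im = 0 := by
    have key : ∀ t : ℝ, 2 * (f a).im * t ≤ ‖a‖ ^ 2 := fun t => by
      have e1 : ‖a + algebraMap ℂ A (t * Complex.I)‖ ^ 2 ≤ ‖a‖ ^ 2 + t ^ 2 := by
        rw [sq, ← CStarRing.norm_star_mul_self]
        have e2 : star (a + algebraMap ℂ A (t * Complex.I)) * (a + algebraMap ℂ A (t * Complex.I))
            = a * a + algebraMap ℂ A ((t : ℂ) ^ 2) := by
          rw [star_add, hsa.star_eq, ← algebraMap_star_comm]
          have e3 : star ((t : ℂ) * Complex.I) = -(t * Complex.I) := by simp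
          have e4 : algebraMap ℂ A ((t : ℂ) ^ 2)
              = -(algebraMap ℂ A (t * Complex.I) * algebraMap ℂ A (t * Complex.I)) := by
            rw [← map_mul, ← map_neg]
            congr 1
            ring_nf
            simp
          rw [e3, map_neg, e4, add_mul, mul_add, mul_add, ← Algebra.commutes]
          noncomm_ring
        rw [e2]
        refine (norm_add_le _ _).trans (add_le_add ?_ ?_)
        · rw [sq]; exact norm_mul_le _ _
        · rcases subsingleton_or_nontrivial A with hA | hA
          · rw [Subsingleton.elim (algebraMap ℂ A ((t : ℂ) ^ 2)) 0, norm_zero]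
            positivity
          · rw [norm_algebraMap']
            simp
      have e5 : ‖f a + t * Complex.I‖ ^ 2 ≤ ‖a‖ ^ 2 + t ^ 2 := by
        refine le_trans ?_ e1
        have := hfx (a + algebraMap ℂ A (t * Complex.I))
        rw [map_add, hscal] at this
        gcongr
      rw [← Complex.normSq_eq_norm_sq, Complex.normSq_apply] at e5
      simp at e5
      nlinarith [mul_self_nonneg (f a).re, mul_self_nonneg (f a).im]
    by_contra hne
    have h := key ((‖a‖ ^ 2 + 1) / (2 * (f a).im))
    rw [mul_div_cancel₀ _ (mul_ne_zero two_ne_zero hne)] at h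
    linarith
  have hre : 0 ≤ (f a).re := by
    have e1 : ‖algebraMap ℝ A ‖a‖ - a‖ ≤ ‖a‖ := by
      nontriviality A
      refine (CStarAlgebra.norm_le_norm_of_nonneg_of_le (b := algebraMap ℝ A ‖a‖) ?_ ?_).trans ?_
      · exact sub_nonneg.mpr hsa.le_algebraMap_norm_self
      · exact sub_le_self _ ha
      · rw [norm_algebraMap', norm_norm]
    have e2 := hfx (algebraMap ℝ A ‖a‖ - a)
    have e3 : f (algebraMap ℝ A ‖a‖) = ((‖a‖ : ℝ) : ℂ) := by
      rw [← hscal ((‖a‖ : ℝ) : ℂ), ← Complex.coe_algebraMap, ← IsScalarTower.algebraMap_apply]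
    rw [map_sub, e3] at e2
    have e4 := (Complex.re_le_norm _).trans (e2.trans e1)
    simp at e4
    exact e4
  exact Complex.nonneg_iff.mpr ⟨hre, him.symm⟩

/-- A functional of norm at most one that maps the unit to one is a state. -/
def State.ofDual (f : StrongDual ℂ A) (hf : ‖f‖ ≤ 1) (h1 : f 1 = 1) : State A where
  toPositiveLinearMap :=
    PositiveLinearMap.mk₀ f.toLinearMap (fun _ ha => nonneg_of_norm_le_one f hf h1 ha)
  apply_one' := h1

open WeakDual in
/-- Every positive element attains its norm at some state. -/
lemma exists_state_apply_eq_norm [Nontrivial A] (c : A) (hc : 0 ≤ c) :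
    ∃ φ : State A, φ c = (‖c‖ : ℂ) := by
  have hsa : IsSelfAdjoint c := .of_nonneg hc
  have : IsStarNormal c := hsa.isStarNormal
  have hmem : (‖c‖ : ℂ) ∈ spectrum ℂ c := by
    have := spectrum.algebraMap_mem ℂ (CStarAlgebra.norm_mem_spectrum_of_nonneg hc)
    simpa using this
  obtain ⟨χ, hχ⟩ := (StarAlgebra.elemental.bijective_characterSpaceToSpectrum c).2 ⟨_, hmem⟩
  have hχc : χ ⟨c, StarAlgebra.elemental.self_mem ℂ c⟩ = (‖c‖ : ℂ) := congrArg Subtype.val hχ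
  let p : Submodule ℂ A := Subalgebra.toSubmodule (StarAlgebra.elemental ℂ c).toSubalgebra
  let g : StrongDual ℂ p := CharacterSpace.toCLM χ
  obtain ⟨f, hf, hn⟩ := exists_extension_norm_eq p g
  have hχn : ∀ y : StarAlgebra.elemental ℂ c, ‖χ y‖ ≤ ‖y‖ := fun y =>
    spectrum.norm_le_norm_of_mem (AlgHom.apply_mem_spectrum χ y)
  have hg : ‖g‖ ≤ 1 := by
    refine ContinuousLinearMap.opNorm_le_bound _ zero_le_one fun x => ?_
    rw [one_mul]
    exact hχn x
  refine ⟨State.ofDual f (hn.trans_le hg) ?_, ?_⟩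
  · exact (hf (1 : StarAlgebra.elemental ℂ c)).trans (map_one χ)
  · exact (hf ⟨c, StarAlgebra.elemental.self_mem ℂ c⟩).trans hχc

end States

section Slices

variable {A B : Type u} [CStarAlgebra A] [CStarAlgebra B]

/-- The norm of an element is the supremum of its norms in representations. -/
lemma norm_le_of_reps (a : A) {c : ℝ} (hc : 0 ≤ c) (h : ∀ π : HilbertRep A, ‖π.π a‖ ≤ c) :
    ‖a‖ ≤ c := by
  let _ : PartialOrder A := CStarAlgebra.spectralOrder A
  have : StarOrderedRing A := CStarAlgebra.spectralOrderedRing A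
  rcases subsingleton_or_nontrivial A with hA | hA
  · rwa [Subsingleton.elim a 0, norm_zero]
  obtain ⟨φ, hφ⟩ := exists_state_apply_eq_norm (star a * a) (star_mul_self_nonneg a)
  have h1 : ((‖φ.gns.π a φ.vec‖ ^ 2 : ℝ) : ℂ) = ((‖a‖ ^ 2 : ℝ) : ℂ) := by
    have := φ.inner_vec (star a * a)
    rw [hφ, CStarRing.norm_star_mul_self, map_mul, map_star, mul_apply_eq_comp,
      ContinuousLinearMap.star_eq_adjoint, ContinuousLinearMap.adjoint_inner_right,
      inner_self_eq_norm_sq_to_K] at this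
    rw [sq ‖a‖, ← this]
    simp
  have h2 : ‖φ.gns.π a φ.vec‖ ^ 2 = ‖a‖ ^ 2 := Complex.ofReal_injective h1
  have h3 : ‖φ.gns.π a φ.vec‖ = ‖a‖ :=
    (pow_left_inj₀ (norm_nonneg _) (norm_nonneg _) two_ne_zero).mp h2
  calc ‖a‖ = ‖φ.gns.π a φ.vec‖ := h3.symm
    _ ≤ ‖φ.gns.π a‖ * ‖φ.vec‖ := ContinuousLinearMap.le_opNorm _ _
    _ ≤ c := by rw [φ.norm_vec, mul_one]; exact h _

section Left
variable [PartialOrder A] [StarOrderedRing A]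

/-- The algebraic slice map `a ⊗ b ↦ φ(a) b`. -/
def leftSliceAlg (φ : State A) : A ⊗[ℂ] B →ₗ[ℂ] B :=
  (TensorProduct.lid ℂ B).toLinearMap ∘ₗ TensorProduct.map φ.toLinearMap LinearMap.id

lemma leftSliceAlg_tmul (φ : State A) (a : A) (b : B) :
    leftSliceAlg φ (a ⊗ₜ[ℂ] b) = φ a • b := rfl

lemma inner_leftSliceAlg (φ : State A) (ρ : HilbertRep B) (t : A ⊗[ℂ] B) (η ξ : ρ.H) :
    inner ℂ η (ρ.π (leftSliceAlg φ t) ξ)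
      = inner ℂ (HilbertTensor.tmul φ.vec η)
          (tensorRep φ.gns ρ t (HilbertTensor.tmul φ.vec ξ)) := by
  induction t using TensorProduct.induction_on with
  | zero => simp
  | tmul a b =>
    rw [leftSliceAlg_tmul, tensorRep_tmul, opTensor_tmul, HilbertTensor.inner_tmul,
      State.inner_vec, map_smul, smul_apply, inner_smul_right]
  | add s t hs ht =>
    rw [map_add, map_add, map_add, add_apply, add_apply, inner_add_right, inner_add_right, hs, ht]

lemma norm_leftSliceAlg_le (φ : State A) (t : A ⊗[ℂ] B) : ‖leftSliceAlg φ t‖ ≤ minNorm t := by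
  refine norm_le_of_reps _ (minNorm_nonneg t) fun ρ => ?_
  refine ContinuousLinearMap.opNorm_le_of_re_inner_le (minNorm_nonneg t) fun ξ η hξ hη => ?_
  rw [inner_re_symm, inner_leftSliceAlg]
  refine (re_inner_le_norm _ _).trans ?_
  rw [HilbertTensor.norm_tmul, φ.norm_vec, hη, one_mul, one_mul]
  refine (ContinuousLinearMap.le_opNorm _ _).trans ?_
  rw [HilbertTensor.norm_tmul, φ.norm_vec, hξ, one_mul, mul_one]
  exact norm_tensorRep_le _ _ t

/-- The slice map `φ ⊗ ι : A ⊗ B → B`. -/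
def leftSlice (φ : State A) : MinTensor A B →L[ℂ] B :=
  MinTensor.extend (leftSliceAlg φ) (norm_leftSliceAlg_le φ)

lemma leftSlice_tmul (φ : State A) (a : A) (b : B) :
    leftSlice φ (MinTensor.tmul a b) = φ a • b :=
  MinTensor.extend_incl _ _ _

lemma norm_leftSlice_le (φ : State A) (y : MinTensor A B) : ‖leftSlice φ y‖ ≤ ‖y‖ := by
  induction y using MinTensor.induction with
  | hc => exact isClosed_le (by fun_prop) (by fun_prop)
  | ht t =>
    rw [leftSlice, MinTensor.extend_incl, MinTensor.norm_incl]
    exact norm_leftSliceAlg_le φ t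

end Left

section Right
variable [PartialOrder B] [StarOrderedRing B]

/-- The algebraic slice map `a ⊗ b ↦ φ(b) a`. -/
def rightSliceAlg (φ : State B) : A ⊗[ℂ] B →ₗ[ℂ] A :=
  (TensorProduct.rid ℂ A).toLinearMap ∘ₗ TensorProduct.map LinearMap.id φ.toLinearMap

lemma rightSliceAlg_tmul (φ : State B) (a : A) (b : B) :
    rightSliceAlg φ (a ⊗ₜ[ℂ] b) = φ b • a := rfl

lemma inner_rightSliceAlg (φ : State B) (ρ : HilbertRep A) (t : A ⊗[ℂ] B) (η ξ : ρ.H) :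
    inner ℂ η (ρ.π (rightSliceAlg φ t) ξ)
      = inner ℂ (HilbertTensor.tmul η φ.vec)
          (tensorRep ρ φ.gns t (HilbertTensor.tmul ξ φ.vec)) := by
  induction t using TensorProduct.induction_on with
  | zero => simp
  | tmul a b =>
    rw [rightSliceAlg_tmul, tensorRep_tmul, opTensor_tmul, HilbertTensor.inner_tmul,
      State.inner_vec, map_smul, smul_apply, inner_smul_right, mul_comm]
  | add s t hs ht =>
    rw [map_add, map_add, map_add, add_apply, add_apply, inner_add_right, inner_add_right, hs, ht]

lemma norm_rightSliceAlg_le (φ : State B) (t : A ⊗[ℂ] B) : ‖rightSliceAlg φ t‖ ≤ minNorm t := by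
  refine norm_le_of_reps _ (minNorm_nonneg t) fun ρ => ?_
  refine ContinuousLinearMap.opNorm_le_of_re_inner_le (minNorm_nonneg t) fun ξ η hξ hη => ?_
  rw [inner_re_symm, inner_rightSliceAlg]
  refine (re_inner_le_norm _ _).trans ?_
  rw [HilbertTensor.norm_tmul, φ.norm_vec, hη, one_mul, one_mul]
  refine (ContinuousLinearMap.le_opNorm _ _).trans ?_
  rw [HilbertTensor.norm_tmul, φ.norm_vec, hξ, one_mul, mul_one]
  exact norm_tensorRep_le _ _ t

/-- The slice map `ι ⊗ φ : A ⊗ B → A`. -/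
def rightSlice (φ : State B) : MinTensor A B →L[ℂ] A :=
  MinTensor.extend (rightSliceAlg φ) (norm_rightSliceAlg_le φ)

lemma rightSlice_tmul (φ : State B) (a : A) (b : B) :
    rightSlice φ (MinTensor.tmul a b) = φ b • a :=
  MinTensor.extend_incl _ _ _

end Right

variable [PartialOrder A] [StarOrderedRing A] [PartialOrder B] [StarOrderedRing B]

lemma State.norm_apply_le (φ : State A) (a : A) : ‖φ a‖ ≤ ‖a‖ := by
  rw [← φ.inner_vec]
  refine (norm_inner_le_norm _ _).trans ?_
  rw [φ.norm_vec, one_mul]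
  refine (ContinuousLinearMap.le_opNorm _ _).trans ?_
  rw [φ.norm_vec, mul_one]
  exact NonUnitalStarAlgHom.norm_apply_le φ.gns.π a

/-- The product functional `φ ⊗ ψ` on the minimal tensor product, continuous with
`(φ ⊗ ψ)(a ⊗ b) = φ(a) ψ(b)`. -/
def State.tensor (φ : State A) (ψ : State B) : StrongDual ℂ (MinTensor A B) :=
  ψ.toDual ∘L leftSlice φ

lemma State.tensor_tmul (φ : State A) (ψ : State B) (a : A) (b : B) :
    φ.tensor ψ (MinTensor.tmul a b) = φ a * ψ b := by
  refine (congrArg ψ.toDual (leftSlice_tmul φ a b)).trans ?_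
  rw [map_smul, smul_eq_mul, State.toDual_apply]

end Slices

/-! ### Compact quantum groups -/

section QuantumGroups

/-- `SameTriple y z` says that `y ∈ (A ⊗ B) ⊗ C` and `z ∈ A ⊗ (B ⊗ C)` (minimal tensor products)
correspond to each other under the canonical identification `(a ⊗ b) ⊗ c ↔ a ⊗ (b ⊗ c)`. The
identification is isometric on the dense algebraic triple tensor products, so its graph is the
closure of the graph of the algebraic associator. -/
def SameTriple {A B C : Type u} [CStarAlgebra A] [CStarAlgebra B] [CStarAlgebra C]
    (y : MinTensor (MinTensor A B) C) (z : MinTensor A (MinTensor B C)) : Prop :=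
  (y, z) ∈ closure (Set.range fun t : (A ⊗[ℂ] B) ⊗[ℂ] C =>
    (MinTensor.incl (MinTensor A B) C
        (TensorProduct.map (MinTensor.incl A B).toLinearMap LinearMap.id t),
      MinTensor.incl A (MinTensor B C)
        (TensorProduct.map LinearMap.id (MinTensor.incl B C).toLinearMap
          (TensorProduct.assoc ℂ A B C t))))

/-- A compact quantum group `(A, Δ)`. -/
structure CompactQuantumGroup (A : Type u) [CStarAlgebra A] where
  /-- the comultiplication, a unital `*`-homomorphism -/
  Δ : A →⋆ₐ[ℂ] MinTensor A A
  /-- `(Δ ⊗ ι) Δ = (ι ⊗ Δ) Δ` -/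
  coassoc : ∀ x : A, SameTriple (MinTensor.map Δ (StarAlgHom.id ℂ A) (Δ x))
    (MinTensor.map (StarAlgHom.id ℂ A) Δ (Δ x))
  dense_left : Dense (Submodule.span ℂ
    {y : MinTensor A A | ∃ a b : A, y = Δ a * MinTensor.tmul b 1} : Set (MinTensor A A))
  dense_right : Dense (Submodule.span ℂ
    {y : MinTensor A A | ∃ a b : A, y = Δ a * MinTensor.tmul 1 b} : Set (MinTensor A A))

namespace CompactQuantumGroup

variable {A : Type u} [CStarAlgebra A] [PartialOrder A] [StarOrderedRing A]
  (G : CompactQuantumGroup A)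

/-- `h` is a Haar state: `(h ⊗ ι) Δ(x) = h(x) 1 = (ι ⊗ h) Δ(x)` for all `x`. -/
def IsHaarState (h : State A) : Prop :=
  ∀ x : A, leftSlice h (G.Δ x) = h x • (1 : A) ∧ rightSlice h (G.Δ x) = h x • (1 : A)

/-- `ε` is a counit: `(ε ⊗ ι) Δ(x) = x = (ι ⊗ ε) Δ(x)` for all `x`. Such a state is the neutral
element for convolution; it need not exist on `A`. -/
def IsCounit (ε : State A) : Prop :=
  ∀ x : A, leftSlice ε (G.Δ x) = x ∧ rightSlice ε (G.Δ x) = x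

/-- The functional `(φ ⊗ ψ) ∘ Δ`. -/
def convDual (φ ψ : State A) : StrongDual ℂ A :=
  LinearMap.mkContinuous ((φ.tensor ψ).toLinearMap ∘ₗ G.Δ.toAlgHom.toLinearMap) 1 (fun x => by
    rw [one_mul]
    exact (ψ.norm_apply_le _).trans
      ((norm_leftSlice_le φ _).trans (NonUnitalStarAlgHom.norm_apply_le G.Δ x)))

/-- The convolution `φ ⋆ ψ = (φ ⊗ ψ) ∘ Δ` of two states. -/
def conv (φ ψ : State A) : State A :=
  State.ofDual (G.convDual φ ψ) (LinearMap.mkContinuous_norm_le _ zero_le_one _) (by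
    change φ.tensor ψ (G.Δ 1) = 1
    have h : (1 : MinTensor A A) = MinTensor.tmul 1 1 :=
      (map_one (MinTensor.incl A A)).symm
    rw [map_one, h, State.tensor_tmul]
    exact (congrArg₂ (· * ·) φ.apply_one' ψ.apply_one').trans (one_mul 1))

lemma conv_apply (φ ψ : State A) (x : A) : G.conv φ ψ x = φ.tensor ψ (G.Δ x) := rfl

/-- `G.convPowSucc φ k` is the convolution power `φ^{⋆(k+1)}`. -/
def convPowSucc (φ : State A) : ℕ → State A
  | 0 => φ
  | k + 1 => G.conv (convPowSucc φ k) φ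

/-- `ψ` is the convolution power `φ^{⋆k}`; for `k = 0` this is the neutral element for convolution,
if there is one on `A`. -/
def IsConvPow (φ : State A) : ℕ → State A → Prop
  | 0, ψ => G.IsCounit ψ
  | k + 1, ψ => ψ = G.convPowSucc φ k

/-- Every nonzero `x ≥ 0` has `φ^{⋆k}(x) > 0` for some `k ≥ m`. -/
def NonDegenerateFrom (m : ℕ) (φ : State A) : Prop :=
  ∀ x : A, 0 ≤ x → x ≠ 0 → ∃ k, m ≤ k ∧ ∃ ψ, G.IsConvPow φ k ψ ∧ 0 < ψ x

/-- The Cesàro mean `(1/n) ∑_{k=1}^n φ^{⋆k}`. -/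
def cesaro (φ : State A) (n : ℕ) : StrongDual ℂ A :=
  (n : ℂ)⁻¹ • ∑ k ∈ Finset.range n, (G.convPowSucc φ k).toDual

end CompactQuantumGroup

/-- A state is faithful if it vanishes at no nonzero positive element. -/
def State.IsFaithful {A : Type u} [CStarAlgebra A] [PartialOrder A] [StarOrderedRing A]
    (h : State A) : Prop :=
  ∀ x : A, 0 ≤ x → h x = 0 → x = 0

end QuantumGroups

end CQG

end

noncomputable section

namespace CQG

universe u

/-! Every weak-* limit point `h` of the Cesàro means absorbs `φ`: convolving a mean with `φ` on
either side changes it only by a telescoping error of order `1/n`, so `h ⋆ φ = h = φ ⋆ h`. The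
problem is to pass from absorption of the single state `φ` to full invariance.

The key is `apply_rightSlice_mul` with its mirror image `apply_leftSlice_mul`. Let `ω` be any state
with `h ⋆ ω = h = ω ⋆ h`, and put `b = (ι ⊗ h)Δ(a)`. Coassociativity and absorption make all four
terms of `(h ⊗ ω)((Δ(b) - b ⊗ 1)(Δ(b) - b ⊗ 1)*)` equal to `h(bb*)` up to sign, so the expression
vanishes. By Cauchy-Schwarz, `(h ⊗ ω)((Δ(b) - b ⊗ 1)(c ⊗ d)) = 0` for all `c`, `d`. Coassociativity
turns this into `ω((ι ⊗ h)Δ(x) d) = h(x) ω(d)` for `x = (h ⊗ ι)(Δ(a)(c ⊗ 1))`, and density of the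
span of the `Δ(a)(c ⊗ 1)` extends it to every `x`.

With `y = (ι ⊗ h)Δ(x) - h(x)1` and `d = y*` this reads `ω(yy*) = 0`. It applies to every convolution
power `ω` of `φ`, so non-degeneracy forces `y = 0`: `h` is a Haar state. Haar states are unique, so
all limit points agree and the means converge. For the converse, if all powers vanish at some `x ≥
0`, so do the means and their limit `h`, and faithfulness gives `x = 0`. -/

lemma State.apply_star {A : Type u} [CStarAlgebra A] [PartialOrder A] [StarOrderedRing A]
    (φ : State A) (a : A) : φ (star a) = star (φ a) := by
  rw [← φ.inner_vec, ← φ.inner_vec, map_star, ContinuousLinearMap.star_eq_adjoint,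
    ContinuousLinearMap.adjoint_inner_right]
  exact (inner_conj_symm _ _).symm

/-- The degenerate case of the Cauchy-Schwarz inequality for a state. -/
lemma State.apply_mul_eq_zero {A : Type u} [CStarAlgebra A] [PartialOrder A] [StarOrderedRing A]
    (φ : State A) {x : A} (hx : φ (x * star x) = 0) (y : A) : φ (x * y) = 0 := by
  have e : φ.gns.π x = ContinuousLinearMap.adjoint (φ.gns.π (star x)) := by
    rw [map_star, ContinuousLinearMap.star_eq_adjoint, ContinuousLinearMap.adjoint_adjoint]
  have h : φ.gns.π (star x) φ.vec = 0 := by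
    rw [← φ.inner_vec, map_mul, mul_apply_eq_comp] at hx
    rw [e, ContinuousLinearMap.adjoint_inner_right] at hx
    exact inner_self_eq_zero.mp hx
  rw [← φ.inner_vec, map_mul, mul_apply_eq_comp, e, ContinuousLinearMap.adjoint_inner_right, h,
    inner_zero_left]

lemma State.ext' {A : Type u} [CStarAlgebra A] [PartialOrder A] [StarOrderedRing A]
    {φ ψ : State A} (h : ∀ x, φ x = ψ x) : φ = ψ := by
  cases φ; cases ψ
  congr 1
  exact DFunLike.ext _ _ h

/-! ### Minimal tensor products: product states, slices and triple tensors -/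

section Tensor

variable {A B : Type u} [CStarAlgebra A] [CStarAlgebra B]

lemma MinTensor.induction_tmul {p : MinTensor A B → Prop} (x : MinTensor A B)
    (hc : IsClosed {x | p x}) (h0 : p 0) (hadd : ∀ x y, p x → p y → p (x + y))
    (ht : ∀ (a : A) (b : B), p (tmul a b)) : p x := by
  refine MinTensor.induction x hc fun t => ?_
  induction t using TensorProduct.induction_on with
  | zero => rw [map_zero]; exact h0
  | tmul a b => exact ht a b
  | add s t hs ht => rw [map_add]; exact hadd _ _ hs ht

lemma MinTensor.tmul_mul_tmul (a a' : A) (b b' : B) :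
    tmul a b * tmul a' b' = tmul (a * a') (b * b') := by
  simp only [tmul, ← map_mul, Algebra.TensorProduct.tmul_mul_tmul]

lemma MinTensor.star_tmul (a : A) (b : B) : star (tmul a b) = tmul (star a) (star b) := by
  simp only [tmul, star_incl, TensorProduct.star_tmul]

lemma MinTensor.tmul_one_one : (tmul 1 1 : MinTensor A B) = 1 := map_one (incl A B)

lemma continuous_starAlgHom (f : A →⋆ₐ[ℂ] B) : Continuous f :=
  AddMonoidHomClass.continuous_of_bound f 1 fun x => by
    rw [one_mul]; exact NonUnitalStarAlgHom.norm_apply_le f x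

/-- The identification of the two triple products is the closure of an algebraic graph, so a closed
additive relation needs checking only on elementary triples. This avoids constructing the associator
as an isomorphism of C*-algebras. -/
lemma SameTriple.induction {C : Type u} [CStarAlgebra C]
    {p : MinTensor (MinTensor A B) C → MinTensor A (MinTensor B C) → Prop}
    {y : MinTensor (MinTensor A B) C} {z : MinTensor A (MinTensor B C)} (h : SameTriple y z)
    (hc : IsClosed {w : MinTensor (MinTensor A B) C × MinTensor A (MinTensor B C) | p w.1 w.2})
    (h0 : p 0 0) (hadd : ∀ y y' z z', p y z → p y' z' → p (y + y') (z + z'))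
    (ht : ∀ (a : A) (b : B) (c : C), p (MinTensor.tmul (MinTensor.tmul a b) c)
      (MinTensor.tmul a (MinTensor.tmul b c))) : p y z := by
  suffices hr : ∀ t : (A ⊗[ℂ] B) ⊗[ℂ] C,
      p (MinTensor.incl (MinTensor A B) C
          (TensorProduct.map (MinTensor.incl A B).toLinearMap LinearMap.id t))
        (MinTensor.incl A (MinTensor B C)
          (TensorProduct.map LinearMap.id (MinTensor.incl B C).toLinearMap
            (TensorProduct.assoc ℂ A B C t))) from
    closure_minimal (Set.range_subset_iff.mpr hr) hc h
  intro t
  induction t using TensorProduct.induction_on with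
  | zero => simpa using h0
  | add s t hs ht =>
    simp only [map_add]
    exact hadd _ _ _ _ hs ht
  | tmul s c =>
    induction s using TensorProduct.induction_on with
    | zero => simpa using h0
    | add s t hs ht =>
      simp only [TensorProduct.add_tmul, map_add]
      exact hadd _ _ _ _ hs ht
    | tmul a b => exact ht a b c

section Slice

section

variable [PartialOrder B] [StarOrderedRing B]

lemma rightSlice_mul_tmul_one (ψ : State B) (y : MinTensor A B) (a : A) :
    rightSlice ψ (y * MinTensor.tmul a 1) = rightSlice ψ y * a := by
  induction y using MinTensor.induction_tmul with
  | hc => exact isClosed_eq (by fun_prop) (by fun_prop)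
  | h0 => simp
  | hadd x y hx hy => simp only [map_add, add_mul, hx, hy]
  | ht a b' => rw [MinTensor.tmul_mul_tmul, rightSlice_tmul, rightSlice_tmul, mul_one,
      smul_mul_assoc]

end

variable [PartialOrder A] [StarOrderedRing A]

lemma leftSlice_mul_tmul_one (φ : State A) (y : MinTensor A B) (b : B) :
    leftSlice φ (y * MinTensor.tmul 1 b) = leftSlice φ y * b := by
  induction y using MinTensor.induction_tmul with
  | hc => exact isClosed_eq (by fun_prop) (by fun_prop)
  | h0 => simp
  | hadd x y hx hy => simp only [map_add, add_mul, hx, hy]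
  | ht a b' => rw [MinTensor.tmul_mul_tmul, leftSlice_tmul, leftSlice_tmul, mul_one, smul_mul_assoc]

variable [PartialOrder B] [StarOrderedRing B]

lemma State.tensor_apply (φ : State A) (ψ : State B) (y : MinTensor A B) :
    φ.tensor ψ y = ψ (leftSlice φ y) := rfl

/-- Fubini for product functionals: `State.tensor` is defined by slicing the first leg first, and
the key argument needs both orders. -/
lemma State.tensor_apply' (φ : State A) (ψ : State B) (y : MinTensor A B) :
    φ.tensor ψ y = φ (rightSlice ψ y) := by
  change φ.tensor ψ y = φ.toDual (rightSlice ψ y)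
  induction y using MinTensor.induction_tmul with
  | hc => exact isClosed_eq (by fun_prop) (by fun_prop)
  | h0 => simp only [map_zero]
  | hadd x y hx hy => simp only [map_add, hx, hy]
  | ht a b => rw [State.tensor_tmul, rightSlice_tmul, map_smul, smul_eq_mul, mul_comm]; rfl

/-- The product functional `φ ⊗ ψ` is the functional of a state. -/
lemma State.exists_state_tensor [PartialOrder (MinTensor A B)] [StarOrderedRing (MinTensor A B)]
    (φ : State A) (ψ : State B) : ∃ χ : State (MinTensor A B), ∀ y, χ y = φ.tensor ψ y := by
  -- Positivity is automatic for a functional of norm at most one with value one at the unit.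
  refine ⟨State.ofDual (φ.tensor ψ) ?_ ?_, fun _ => rfl⟩
  · refine ContinuousLinearMap.opNorm_le_bound _ zero_le_one fun y => ?_
    rw [one_mul]
    exact (ψ.norm_apply_le _).trans (norm_leftSlice_le φ y)
  · rw [← MinTensor.tmul_one_one, State.tensor_tmul]
    exact (congrArg₂ (· * ·) φ.apply_one' ψ.apply_one').trans (one_mul 1)

lemma State.tensor_star (φ : State A) (ψ : State B) (y : MinTensor A B) :
    φ.tensor ψ (star y) = star (φ.tensor ψ y) := by
  -- The spectral order makes sense of states on the tensor product; the conclusion does not depend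
  -- on it.
  let _ : PartialOrder (MinTensor A B) := CStarAlgebra.spectralOrder _
  have : StarOrderedRing (MinTensor A B) := CStarAlgebra.spectralOrderedRing _
  obtain ⟨χ, hχ⟩ := φ.exists_state_tensor ψ
  rw [← hχ, ← hχ, State.apply_star]

lemma State.tensor_mul_eq_zero (φ : State A) (ψ : State B) {x : MinTensor A B}
    (hx : φ.tensor ψ (x * star x) = 0) (y : MinTensor A B) : φ.tensor ψ (x * y) = 0 := by
  let _ : PartialOrder (MinTensor A B) := CStarAlgebra.spectralOrder _
  have : StarOrderedRing (MinTensor A B) := CStarAlgebra.spectralOrderedRing _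
  obtain ⟨χ, hχ⟩ := φ.exists_state_tensor ψ
  rw [← hχ] at hx ⊢
  exact χ.apply_mul_eq_zero hx y

lemma leftSlice_map {C D : Type u} [CStarAlgebra C] [CStarAlgebra D] (φ : State A)
    (f : C →⋆ₐ[ℂ] D) (y : MinTensor A C) (a : A) :
    leftSlice φ (MinTensor.map (StarAlgHom.id ℂ A) f y * MinTensor.tmul a 1)
      = f (leftSlice φ (y * MinTensor.tmul a 1)) := by
  have hf : Continuous f := continuous_starAlgHom f
  induction y using MinTensor.induction_tmul with
  | hc => exact isClosed_eq (by fun_prop) (by fun_prop)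
  | h0 => simp
  | hadd x y hx hy => simp only [map_add, add_mul, hx, hy]
  | ht b c =>
    rw [MinTensor.map_tmul, MinTensor.tmul_mul_tmul, MinTensor.tmul_mul_tmul, leftSlice_tmul,
      leftSlice_tmul, map_smul, mul_one, mul_one]
    rfl

lemma rightSlice_map {C D : Type u} [CStarAlgebra C] [CStarAlgebra D] (ψ : State B)
    (f : C →⋆ₐ[ℂ] D) (y : MinTensor C B) (b : B) :
    rightSlice ψ (MinTensor.map f (StarAlgHom.id ℂ B) y * MinTensor.tmul 1 b)
      = f (rightSlice ψ (y * MinTensor.tmul 1 b)) := by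
  have hf : Continuous f := continuous_starAlgHom f
  induction y using MinTensor.induction_tmul with
  | hc => exact isClosed_eq (by fun_prop) (by fun_prop)
  | h0 => simp
  | hadd x y hx hy => simp only [map_add, add_mul, hx, hy]
  | ht c b' =>
    rw [MinTensor.map_tmul, MinTensor.tmul_mul_tmul, MinTensor.tmul_mul_tmul, rightSlice_tmul,
      rightSlice_tmul, map_smul, mul_one, mul_one]
    rfl

/-- Slicing the outer legs of a triple tensor is compatible with reassociation. -/
lemma SameTriple.slice {C : Type u} [CStarAlgebra C] (φ : State A) (ψ : State B)
    {y : MinTensor (MinTensor A C) B} {z : MinTensor A (MinTensor C B)} (h : SameTriple y z)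
    (a : A) (b : B) :
    leftSlice φ (rightSlice ψ (y * MinTensor.tmul 1 b) * MinTensor.tmul a 1)
      = rightSlice ψ (leftSlice φ (z * MinTensor.tmul a 1) * MinTensor.tmul 1 b) := by
  refine h.induction (p := fun y z =>
    leftSlice φ (rightSlice ψ (y * MinTensor.tmul 1 b) * MinTensor.tmul a 1)
      = rightSlice ψ (leftSlice φ (z * MinTensor.tmul a 1) * MinTensor.tmul 1 b))
    (isClosed_eq (by fun_prop) (by fun_prop)) (by simp) ?_ ?_
  · intro y y' z z' hy hz
    simp only [map_add, add_mul, hy, hz]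
  · intro a' c b'
    -- On an elementary triple both sides are `φ(a'a) ψ(b'b) c`.
    simp only [MinTensor.tmul_mul_tmul, leftSlice_tmul, rightSlice_tmul, mul_one,
      smul_mul_assoc, map_smul]
    exact smul_comm _ _ _

end Slice

end Tensor

/-! ### Coassociativity, convolution and the Cauchy-Schwarz argument -/

namespace CompactQuantumGroup

variable {A : Type u} [CStarAlgebra A] [PartialOrder A] [StarOrderedRing A]
  (G : CompactQuantumGroup A)

/-- Coassociativity, with the outer legs sliced by `φ(· a)` and `ψ(· b)`. -/
lemma slice_coassoc (φ ψ : State A) (x a b : A) :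
    leftSlice φ (G.Δ (rightSlice ψ (G.Δ x * MinTensor.tmul 1 b)) * MinTensor.tmul a 1)
      = rightSlice ψ (G.Δ (leftSlice φ (G.Δ x * MinTensor.tmul a 1)) * MinTensor.tmul 1 b) := by
  -- A slice of one leg commutes with applying `Δ` to the other, so both sides become double slices
  -- of the two iterated comultiplications.
  rw [← rightSlice_map, ← leftSlice_map]
  exact (G.coassoc x).slice φ ψ a b

lemma conv_assoc (φ ψ χ : State A) : G.conv (G.conv φ ψ) χ = G.conv φ (G.conv ψ χ) := by
  refine State.ext' fun x => ?_
  -- Both triple convolutions slice the outer legs by `φ` and `χ` and then apply `ψ` to the middle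
  -- one.
  have h := G.slice_coassoc φ χ x 1 1
  simp only [MinTensor.tmul_one_one, mul_one] at h
  rw [conv_apply, State.tensor_apply', conv_apply, State.tensor_apply, h, conv_apply,
    State.tensor_apply, conv_apply, State.tensor_apply']

variable {G} in
/-- If `h ⋆ ω = h = ω ⋆ h`, then `(ι ⊗ h) Δ(x) - h(x) 1` is negligible for `ω`. -/
lemma apply_rightSlice_mul {h ω : State A} (h₁ : G.conv h ω = h) (h₂ : G.conv ω h = h) (x d : A) :
    ω (rightSlice h (G.Δ x) * d) = h x * ω d := by
  -- the identity for `x = (h ⊗ ι)(Δ(a)(c ⊗ 1))`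
  have key : ∀ a c : A, ω (rightSlice h (G.Δ (leftSlice h (G.Δ a * MinTensor.tmul c 1))) * d)
      = h (leftSlice h (G.Δ a * MinTensor.tmul c 1)) * ω d := by
    intro a
    set b := rightSlice h (G.Δ a)
    have hco : ∀ c, leftSlice h (G.Δ b * MinTensor.tmul c 1)
        = rightSlice h (G.Δ (leftSlice h (G.Δ a * MinTensor.tmul c 1))) := fun c => by
      have := G.slice_coassoc h h a c 1
      simpa only [MinTensor.tmul_one_one, mul_one] using this
    have hhb : ∀ c, h (leftSlice h (G.Δ a * MinTensor.tmul c 1)) = h (b * c) := fun c => by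
      rw [← State.tensor_apply, State.tensor_apply', rightSlice_mul_tmul_one]
    -- With `u = (h ⊗ ι)(Δ(a)(c ⊗ 1))`, coassociativity turns the left side into `(ω ⋆ h)(u) = h(u)
    -- = h(bc)`. The case `c = b*` supplies the cross terms below.
    have hT : ∀ c, h.tensor ω (G.Δ b * MinTensor.tmul c 1) = h (b * c) := fun c => by
      rw [State.tensor_apply, hco, ← State.tensor_apply', ← conv_apply, h₂, hhb]
    have hb₁ : ∀ c e, h.tensor ω (MinTensor.tmul c e) = h c * ω e := State.tensor_tmul h ω
    have hzero : h.tensor ω ((G.Δ b - MinTensor.tmul b 1) * star (G.Δ b - MinTensor.tmul b 1))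
        = 0 := by
      have e1 : h.tensor ω (G.Δ b * star (G.Δ b)) = h (b * star b) := by
        rw [← map_star, ← map_mul, ← conv_apply, h₁]
      have e2 : h.tensor ω (G.Δ b * star (MinTensor.tmul b 1)) = h (b * star b) := by
        rw [MinTensor.star_tmul, star_one, hT]
      have e3 : h.tensor ω (MinTensor.tmul b 1 * star (G.Δ b)) = h (b * star b) := by
        rw [← star_star (MinTensor.tmul b 1), ← star_mul, State.tensor_star, e2,
          ← State.apply_star, star_mul, star_star]
      have e4 : h.tensor ω (MinTensor.tmul b 1 * star (MinTensor.tmul b 1)) = h (b * star b) := by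
        rw [MinTensor.star_tmul, MinTensor.tmul_mul_tmul, hb₁, star_one, mul_one]
        exact (congrArg _ ω.apply_one').trans (mul_one _)
      rw [star_sub, sub_mul, mul_sub, mul_sub, map_sub, map_sub, map_sub, e1, e2, e3, e4]
      ring
    intro c
    -- Cauchy-Schwarz replaces `Δ(b)` by `b ⊗ 1` against any `c ⊗ d`, which frees the factor `ω(d)`.
    have h0 := State.tensor_mul_eq_zero h ω hzero (MinTensor.tmul c d)
    rw [sub_mul, map_sub, sub_eq_zero, MinTensor.tmul_mul_tmul, hb₁, one_mul] at h0
    rw [hhb, ← h0, ← hco, ← leftSlice_mul_tmul_one, ← State.tensor_apply, mul_assoc,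
      MinTensor.tmul_mul_tmul, one_mul, mul_one]
  have hΔ : Continuous G.Δ := continuous_starAlgHom G.Δ
  -- Both sides are linear and continuous in the tensor being sliced, so the identity passes from
  -- the `Δ(a)(c ⊗ 1)` to their closed span, which is everything.
  have hcl : IsClosed {y : MinTensor A A |
      ω.toDual (rightSlice h (G.Δ (leftSlice h y)) * d) = h.toDual (leftSlice h y) * ω d} :=
    isClosed_eq (by fun_prop) (by fun_prop)
  have hall : ∀ y : MinTensor A A,
      ω.toDual (rightSlice h (G.Δ (leftSlice h y)) * d) = h.toDual (leftSlice h y) * ω d := by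
    intro y
    refine closure_minimal ?_ hcl (G.dense_left y)
    intro z hz
    induction hz using Submodule.span_induction with
    | mem z hz =>
      obtain ⟨a, c, rfl⟩ := hz
      exact key a c
    | zero => simp
    | add y z _ _ hy hz =>
      simp only [Set.mem_ofPred_eq, map_add, add_mul] at hy hz ⊢
      rw [hy, hz]
    | smul k y _ hy =>
      simp only [Set.mem_ofPred_eq, map_smul, smul_mul_assoc, smul_eq_mul] at hy ⊢
      rw [hy, mul_assoc]
  -- Since `h(1) = 1`, every `x` is the slice of `1 ⊗ x`.
  have h1 : leftSlice h (MinTensor.tmul 1 x) = x := by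
    rw [leftSlice_tmul]
    exact (congrArg (· • x) h.apply_one').trans (one_smul ℂ x)
  have h2 := hall (MinTensor.tmul 1 x)
  rwa [h1] at h2

variable {G} in
/-- If `h ⋆ ω = h = ω ⋆ h`, then `(h ⊗ ι) Δ(x) - h(x) 1` is negligible for `ω`. -/
lemma apply_leftSlice_mul {h ω : State A} (h₁ : G.conv h ω = h) (h₂ : G.conv ω h = h) (x d : A) :
    ω (leftSlice h (G.Δ x) * d) = h x * ω d := by
  -- the identity for `x = (ι ⊗ h)(Δ(a)(1 ⊗ c))`
  have key : ∀ a c : A, ω (leftSlice h (G.Δ (rightSlice h (G.Δ a * MinTensor.tmul 1 c))) * d)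
      = h (rightSlice h (G.Δ a * MinTensor.tmul 1 c)) * ω d := by
    intro a
    -- The legs are exchanged: `Δ(b)` is compared with `1 ⊗ b` under `ω ⊗ h`, and the two absorption
    -- hypotheses swap roles.
    set b := leftSlice h (G.Δ a)
    have hco : ∀ c, rightSlice h (G.Δ b * MinTensor.tmul 1 c)
        = leftSlice h (G.Δ (rightSlice h (G.Δ a * MinTensor.tmul 1 c))) := fun c => by
      have := (G.slice_coassoc h h a 1 c).symm
      simpa only [MinTensor.tmul_one_one, mul_one] using this
    have hhb : ∀ c, h (rightSlice h (G.Δ a * MinTensor.tmul 1 c)) = h (b * c) := fun c => by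
      rw [← State.tensor_apply', State.tensor_apply, leftSlice_mul_tmul_one]
    have hT : ∀ c, ω.tensor h (G.Δ b * MinTensor.tmul 1 c) = h (b * c) := fun c => by
      rw [State.tensor_apply', hco, ← State.tensor_apply, ← conv_apply, h₁, hhb]
    have hb₁ : ∀ c e, ω.tensor h (MinTensor.tmul c e) = ω c * h e := State.tensor_tmul ω h
    have hzero : ω.tensor h ((G.Δ b - MinTensor.tmul 1 b) * star (G.Δ b - MinTensor.tmul 1 b))
        = 0 := by
      have e1 : ω.tensor h (G.Δ b * star (G.Δ b)) = h (b * star b) := by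
        rw [← map_star, ← map_mul, ← conv_apply, h₂]
      have e2 : ω.tensor h (G.Δ b * star (MinTensor.tmul 1 b)) = h (b * star b) := by
        rw [MinTensor.star_tmul, star_one, hT]
      have e3 : ω.tensor h (MinTensor.tmul 1 b * star (G.Δ b)) = h (b * star b) := by
        rw [← star_star (MinTensor.tmul 1 b), ← star_mul, State.tensor_star, e2,
          ← State.apply_star, star_mul, star_star]
      have e4 : ω.tensor h (MinTensor.tmul 1 b * star (MinTensor.tmul 1 b)) = h (b * star b) := by
        rw [MinTensor.star_tmul, MinTensor.tmul_mul_tmul, hb₁, star_one, mul_one]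
        exact (congrArg (· * _) ω.apply_one').trans (one_mul _)
      rw [star_sub, sub_mul, mul_sub, mul_sub, map_sub, map_sub, map_sub, e1, e2, e3, e4]
      ring
    intro c
    have h0 := State.tensor_mul_eq_zero ω h hzero (MinTensor.tmul d c)
    rw [sub_mul, map_sub, sub_eq_zero, MinTensor.tmul_mul_tmul, hb₁, one_mul] at h0
    rw [hhb, mul_comm, ← h0, ← hco, ← rightSlice_mul_tmul_one, ← State.tensor_apply', mul_assoc,
      MinTensor.tmul_mul_tmul, one_mul, mul_one]
  have hΔ : Continuous G.Δ := continuous_starAlgHom G.Δ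
  have hcl : IsClosed {y : MinTensor A A |
      ω.toDual (leftSlice h (G.Δ (rightSlice h y)) * d) = h.toDual (rightSlice h y) * ω d} :=
    isClosed_eq (by fun_prop) (by fun_prop)
  have hall : ∀ y : MinTensor A A,
      ω.toDual (leftSlice h (G.Δ (rightSlice h y)) * d) = h.toDual (rightSlice h y) * ω d := by
    intro y
    refine closure_minimal ?_ hcl (G.dense_right y)
    intro z hz
    induction hz using Submodule.span_induction with
    | mem z hz =>
      obtain ⟨a, c, rfl⟩ := hz
      exact key a c
    | zero => simp
    | add y z _ _ hy hz =>
      simp only [Set.mem_ofPred_eq, map_add, add_mul] at hy hz ⊢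
      rw [hy, hz]
    | smul k y _ hy =>
      simp only [Set.mem_ofPred_eq, map_smul, smul_mul_assoc, smul_eq_mul] at hy ⊢
      rw [hy, mul_assoc]
  have h1 : rightSlice h (MinTensor.tmul x 1) = x := by
    rw [rightSlice_tmul]
    exact (congrArg (· • x) h.apply_one').trans (one_smul ℂ x)
  have h2 := hall (MinTensor.tmul x 1)
  rwa [h1] at h2

/-! ### Haar states: uniqueness, and invariance from absorption -/

variable {G} in
-- Evaluate `(h ⊗ h')Δ` in two ways: invariance of `h` gives `h`, invariance of `h'` gives `h'`.
lemma IsHaarState.unique {h h' : State A} (hh : G.IsHaarState h) (hh' : G.IsHaarState h') :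
    h = h' := by
  refine State.ext' fun x => ?_
  have e1 : h.tensor h' (G.Δ x) = h x := by
    rw [State.tensor_apply, (hh x).1, map_smul, smul_eq_mul]
    exact (congrArg _ h'.apply_one').trans (mul_one _)
  have e2 : h.tensor h' (G.Δ x) = h' x := by
    rw [State.tensor_apply', (hh' x).2, map_smul, smul_eq_mul]
    exact (congrArg _ h.apply_one').trans (mul_one _)
  rw [← e1, e2]

/-- Powers are built by convolving on the right; the left-hand recursion is what yields `φ ⋆ h = h`
for limits of Cesàro means. -/
lemma conv_convPowSucc (φ : State A) (k : ℕ) :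
    G.conv φ (G.convPowSucc φ k) = G.convPowSucc φ (k + 1) := by
  induction k with
  | zero => rfl
  | succ k ih => rw [convPowSucc, ← conv_assoc, ih]; rfl

variable {G} in
-- Absorption passes from `φ` to its powers by associativity. The exponent zero must be covered
-- because non-degeneracy allows it, and there the counit is neutral for every state.
lemma IsConvPow.conv_eq {h φ : State A} (h₁ : G.conv h φ = h) (h₂ : G.conv φ h = h) {k : ℕ}
    {ψ : State A} (hψ : G.IsConvPow φ k ψ) : G.conv h ψ = h ∧ G.conv ψ h = h := by
  cases k with
  | zero =>
    constructor <;> refine State.ext' fun x => ?_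
    · rw [conv_apply, State.tensor_apply', (hψ x).2]
    · rw [conv_apply, State.tensor_apply, (hψ x).1]
  | succ k =>
    obtain rfl : ψ = G.convPowSucc φ k := hψ
    induction k with
    | zero => exact ⟨h₁, h₂⟩
    | succ k ih =>
      rw [convPowSucc, ← conv_assoc, ih.1, conv_assoc, h₂]
      exact ⟨h₁, ih.2⟩

variable {G} in
lemma NonDegenerateFrom.eq_zero {m : ℕ} {φ : State A} (hφ : G.NonDegenerateFrom m φ) {y : A}
    (hy : ∀ k ψ, G.IsConvPow φ k ψ → ψ (y * star y) = 0) : y = 0 := by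
  by_contra hne
  obtain ⟨k, -, ψ, hψ, hpos⟩ := hφ (y * star y) (mul_star_self_nonneg y)
    (fun h => hne ((CStarRing.mul_star_self_eq_zero_iff y).mp h))
  exact hpos.ne' (hy k ψ hψ)

variable {G} in
/-- For a non-degenerate `φ`, a state that absorbs `φ` on both sides is a Haar state. -/
lemma NonDegenerateFrom.isHaarState {m : ℕ} {φ h : State A} (hφ : G.NonDegenerateFrom m φ)
    (h₁ : G.conv h φ = h) (h₂ : G.conv φ h = h) : G.IsHaarState h := by
  intro x
  constructor <;> refine sub_eq_zero.mp (hφ.eq_zero fun k ψ hψ => ?_)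
  all_goals
    obtain ⟨e₁, e₂⟩ := hψ.conv_eq h₁ h₂
    -- Only the left factor `y` of `yy*` is expanded; `y*` plays the role of the free factor `d`.
    rw [sub_mul, map_sub, smul_mul_assoc, one_mul, map_smul, smul_eq_mul, sub_eq_zero]
  · exact apply_leftSlice_mul e₁ e₂ x _
  · exact apply_rightSlice_mul e₁ e₂ x _

/-! ### Cesàro means and their weak-* limit points -/

lemma cesaro_apply (φ : State A) (n : ℕ) (x : A) :
    G.cesaro φ n x = (n : ℂ)⁻¹ * ∑ k ∈ Finset.range n, G.convPowSucc φ k x := by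
  simp [cesaro]

lemma norm_cesaro_apply_le (φ : State A) (n : ℕ) (x : A) : ‖G.cesaro φ n x‖ ≤ ‖x‖ := by
  rw [cesaro_apply, norm_mul, norm_inv, Complex.norm_natCast]
  have h : ‖∑ k ∈ Finset.range n, G.convPowSucc φ k x‖ ≤ n * ‖x‖ := by
    refine (norm_sum_le_of_le _ fun k _ => (G.convPowSucc φ k).norm_apply_le x).trans_eq ?_
    simp
  rcases n.eq_zero_or_pos with rfl | hn
  · simp
  · have hn' : (0 : ℝ) < n := by exact_mod_cast hn
    rw [inv_mul_le_iff₀ hn']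
    exact h

lemma cesaro_one (φ : State A) {n : ℕ} (hn : n ≠ 0) : G.cesaro φ n 1 = 1 := by
  have h : ∀ k, G.convPowSucc φ k 1 = 1 := fun k => (G.convPowSucc φ k).apply_one'
  rw [cesaro_apply]
  simp [h, hn]

/-- The hypothesis says that passing from `x` to `y` shifts the powers by one, so the difference of
the means telescopes to two terms divided by `n`. -/
lemma tendsto_cesaro_sub (φ : State A) {x y : A}
    (hxy : ∀ k, G.convPowSucc φ k y = G.convPowSucc φ (k + 1) x) :
    Filter.Tendsto (fun n => G.cesaro φ n y - G.cesaro φ n x) Filter.atTop (nhds 0) := by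
  have hb : ∀ n, ‖G.cesaro φ n y - G.cesaro φ n x‖ ≤ 2 * ‖x‖ * (n : ℝ)⁻¹ := fun n => by
    rw [cesaro_apply, cesaro_apply, ← mul_sub, ← Finset.sum_sub_distrib]
    simp_rw [hxy]
    rw [Finset.sum_range_sub (fun k => G.convPowSucc φ k x), norm_mul, norm_inv,
      Complex.norm_natCast, mul_comm]
    gcongr
    refine (norm_sub_le _ _).trans ?_
    have h1 := (G.convPowSucc φ n).norm_apply_le x
    have h2 := (G.convPowSucc φ 0).norm_apply_le x
    linarith
  refine squeeze_zero_norm hb ?_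
  simpa using tendsto_inv_atTop_nhds_zero_nat.const_mul (2 * ‖x‖)

/-- Along every ultrafilter the Cesàro means converge to a state that absorbs `φ`. -/
lemma exists_tendsto_cesaro (φ : State A) (U : Ultrafilter ℕ) (hU : (U : Filter ℕ) ≤ Filter.atTop) :
    ∃ h : State A, Filter.Tendsto (fun n => StrongDual.toWeakDual (G.cesaro φ n)) U
      (nhds (StrongDual.toWeakDual h.toDual)) ∧ G.conv h φ = h ∧ G.conv φ h = h := by
  have hmem : ∀ n, StrongDual.toWeakDual (G.cesaro φ n) ∈
      WeakDual.toStrongDual ⁻¹' Metric.closedBall (0 : StrongDual ℂ A) 1 := fun n => by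
    rw [Set.mem_preimage, mem_closedBall_zero_iff]
    refine ContinuousLinearMap.opNorm_le_bound _ zero_le_one fun x => ?_
    rw [one_mul]
    exact G.norm_cesaro_apply_le φ n x
  -- Banach-Alaoglu. Ultrafilters replace subsequences, since `A` need not be separable.
  obtain ⟨f, hf, hlim⟩ := (WeakDual.isCompact_closedBall (𝕜 := ℂ) (0 : StrongDual ℂ A) 1)
    |>.ultrafilter_le_nhds (U.map fun n => StrongDual.toWeakDual (G.cesaro φ n))
      (Filter.le_principal_iff.mpr (Filter.mem_map.mpr (Filter.univ_mem' hmem)))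
  have hlim' : Filter.Tendsto (fun n => StrongDual.toWeakDual (G.cesaro φ n)) U (nhds f) := hlim
  have hev : ∀ x, Filter.Tendsto (fun n => G.cesaro φ n x) U (nhds (f x)) := fun x =>
    ((WeakDual.eval_continuous x).tendsto f).comp hlim'
  have h1 : f 1 = 1 := by
    refine tendsto_nhds_unique (hev 1) (tendsto_const_nhds.congr' ?_)
    -- The mean at `n = 0` is the zero functional, so the value at the unit is one only eventually.
    filter_upwards [hU (Filter.eventually_ne_atTop 0)] with n hn
    exact (G.cesaro_one φ hn).symm
  let h : State A := State.ofDual (WeakDual.toStrongDual f) (by simpa using hf) h1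
  have hinv : ∀ {x y : A}, (∀ k, G.convPowSucc φ k y = G.convPowSucc φ (k + 1) x) →
      h y = h x := fun {x y} hxy => by
    have := tendsto_nhds_unique ((hev y).sub (hev x)) ((G.tendsto_cesaro_sub φ hxy).mono_left hU)
    exact sub_eq_zero.mp this
  refine ⟨h, hlim', State.ext' fun x => ?_, State.ext' fun x => ?_⟩
  -- Here the shift comes from `y = (ι ⊗ φ)Δ(x)`; in the next case it comes from `y = (φ ⊗ ι)Δ(x)`.
  · rw [conv_apply, State.tensor_apply']
    exact hinv fun k => by rw [← State.tensor_apply']; rfl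
  · rw [conv_apply, State.tensor_apply]
    exact hinv fun k => by rw [← State.tensor_apply, ← conv_apply, conv_convPowSucc]

end CompactQuantumGroup

end CQG

end

/-! ### The theorem -/

theorem mainTheorem7 {A : Type*} [CStarAlgebra A] [PartialOrder A] [StarOrderedRing A]
    (G : CQG.CompactQuantumGroup A) (φ : CQG.State A) :
    (G.NonDegenerateFrom 0 φ →
      (∃! h : CQG.State A, G.IsHaarState h) ∧
      ∀ h : CQG.State A, G.IsHaarState h →
        Filter.Tendsto (fun n : ℕ => StrongDual.toWeakDual (G.cesaro φ n)) Filter.atTop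
          (nhds (StrongDual.toWeakDual h.toDual))) ∧
    (∀ h : CQG.State A, G.IsHaarState h → h.IsFaithful →
      Filter.Tendsto (fun n : ℕ => StrongDual.toWeakDual (G.cesaro φ n)) Filter.atTop
        (nhds (StrongDual.toWeakDual h.toDual)) →
      G.NonDegenerateFrom 1 φ) := by
  refine ⟨fun hφ => ⟨?_, fun h hh => ?_⟩, fun h _ hfaith hlim x hx hne => ?_⟩
  · obtain ⟨h, -, h₁, h₂⟩ := G.exists_tendsto_cesaro φ (Ultrafilter.of Filter.atTop)
      (Ultrafilter.of_le _)
    exact ⟨h, hφ.isHaarState h₁ h₂, fun h' hh' => hh'.unique (hφ.isHaarState h₁ h₂)⟩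
  -- Along each ultrafilter the limit is a Haar state, hence `h` by uniqueness; a common limit along
  -- all ultrafilters is a limit.
  · refine (Filter.tendsto_iff_ultrafilter _ _ _).mpr fun U hU => ?_
    obtain ⟨h', hlim, h₁, h₂⟩ := G.exists_tendsto_cesaro φ U hU
    rwa [hh.unique (hφ.isHaarState h₁ h₂)]
  · by_contra! hcon
    have hzero : ∀ k, G.convPowSucc φ k x = 0 := fun k => by
      by_contra hk
      have hnn : 0 ≤ G.convPowSucc φ k x :=
        map_nonneg (G.convPowSucc φ k).toPositiveLinearMap hx
      -- `convPowSucc φ k` is the power with exponent `k + 1`, so the exponent is at least one and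
      -- no counit enters.
      exact hcon (k + 1) (by omega) _ rfl (lt_of_le_of_ne hnn (Ne.symm hk))
    have hev : Filter.Tendsto (fun n => G.cesaro φ n x) Filter.atTop (nhds (h x)) :=
      ((WeakDual.eval_continuous x).tendsto _).comp hlim
    refine hne (hfaith x hx (tendsto_nhds_unique hev (tendsto_const_nhds.congr fun n => ?_)))
    rw [G.cesaro_apply]
    simp [hzero]
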